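/- Let $\mathbb F$ be a finite field, let $\ell,s,d,m,n\ge 1$ and $t\ge 0$ be integers with $m\ge d$ and $\ell\le n$, and let $\mathrm{POLY}_{d,m}(\mathbb F)$ be the set of $m$-variate polynomials over $\mathbb F$ of total degree at most $d$. Let $\mathcal F\subseteq \mathrm{POLY}_{d,m}(\mathbb F)^\ell$ be non-trivial: some $(f_1,\dots,f_\ell)\in\mathcal F$ is such that every $f_i$ contains a monomial with at least $d$ distinct variables. An $s$-server $\mathbb F$-linear HSS $\pi=(\mathsf{Share},\mathsf{Eval},\mathsf{Rec})$ for $\mathcal F$ consists of a finite $\mathbb F$-vector space $\mathcal R$, an $\mathbb F$-vector space $\mathcal Y$, integers $n_1,\dots,n_s\ge 0$, an $\mathbb F$-linear map $\mathsf{Share}:\mathbb F\times\mathcal R\to\mathcal Y^s$, arbitrary functions $\mathsf{Eval}(\mathbf f,j,\cdot):\mathcal Y^{\ell m}\to\mathbb F^{n_j}$ for $\mathbf f\in\mathcal F$ and $j\in[s]$, and an $\mathbb F$-linear map $\mathsf{Rec}:\mathbb F^{n_1+\dots+n_s}\to\mathbb F^\ell$. It has to be correct: for all $\mathbf f=(f_1,\dots,f_\ell)\in\mathcal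 F$ and all $\mathbf x^{(1)},\dots,\mathbf x^{(\ell)}\in\mathbb F^m$, if each $x^{(i)}_k$ is shared with an independent uniform seed from $\mathcal R$ and each server $j$ applies $\mathsf{Eval}(\mathbf f,j,\cdot)$ to all the $j$-th shares, then $\mathsf{Rec}$ maps the outputs to $(f_1(\mathbf x^{(1)}),\dots,f_\ell(\mathbf x^{(\ell)}))$ with probability $1$. It is $t$-private if, for every $T\subseteq[s]$ with $|T|\le t$, the joint distribution of the shares $\mathsf{Share}(x,r)_j$, $j\in T$, over uniform $r\in\mathcal R$, is the same for all $x\in\mathbb F$. Its download rate is $\log_2|\mathbb F^\ell|\,/\sum_j n_j\log_2|\mathbb F|$. If $\sum_j n_j=n$, then listing the output symbols in any order as $z_1,\dots,z_n$ gives a reconstruction matrix $G\in\mathbb F^{\ell\times n}$, defined by $\mathsf{Rec}(\mathbf z)=G\mathbf z$, and a map $L:[n]\to[s]$, where $L(r)$ is the server that sends $z_r$; we call $(G,L)$ a reconstruction pair of $\pi$. A linear code $\mathcal C\subseteq\mathbb F^n$ has rate $\dim(\mathcal C)/n$. For a labeling $L:[n]\to[s]$ (any map) let $\Delta_L(\mathcal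 C)=\min_{c\in\mathcal C\setminus\{0\}}|\{L(i): c_i\ne 0\}|$. A matrix in $\mathbb F^{\ell\times n}$ is a generator matrix of $\mathcal C$ if $\dim\mathcal C=\ell$ and its row span is $\mathcal C$. Theorem. (1) There is a $t$-private, $s$-server $\mathbb F$-linear HSS for $\mathcal F$ with download rate $\ell/n$ if and only if there are a linear code $\mathcal C\subseteq\mathbb F^n$ of rate $\ell/n$ and a labeling $L:[n]\to[s]$ with $\Delta_L(\mathcal C)\ge dt+1$. (2) If $s\le n$, then (1) also holds with "a surjective labeling" in place of "a labeling". (3) Every $t$-private, $s$-server $\mathbb F$-linear HSS for $\mathcal F$ with download rate $\ell/n$ has a reconstruction pair, and for each of its reconstruction pairs $(G,L)$ the matrix $G$ is a generator matrix of a linear code $\mathcal C\subseteq\mathbb F^n$ of rate $\ell/n$ with $\Delta_L(\mathcal C)\ge dt+1$. (4) Conversely, for every linear code $\mathcal C\subseteq\mathbb F^n$ of rate $\ell/n$, every labeling $L:[n]\to[s]$ with $\Delta_L(\mathcal C)\ge dt+1$ and every generator matrix $G$ of $\mathcal C$, there is a $t$-private, $s$-server $\mathbb F$-linear HSS for $\mathcal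 F$ with download rate $\ell/n$ that has the reconstruction pair $(G,L)$. -/

import Mathlib

/-! Homomorphic secret sharing of low-degree polynomials, and labelweights of linear codes.
Throughout, `[k]` is `Fin k`. -/

noncomputable section

universe u

/-- `POLY_{d,m}(F)`: the `m`-variate polynomials over `F` of total degree at most `d`. -/
def PolyClass (F : Type u) [Field F] (d m : ℕ) : Set (MvPolynomial (Fin m) F) :=
  {f | f.totalDegree ≤ d}

/-- `POLY_{d,m}(F)^ℓ`: the `ℓ`-tuples of such polynomials. -/
def PolyClassPow (F : Type u) [Field F] (d m ℓ : ℕ) : Set (Fin ℓ → MvPolynomial (Fin m) F) :=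
  {f | ∀ i, f i ∈ PolyClass F d m}

/-- A class of tuples is non-trivial (for the degree `d`) if it has a member `(f_1, …, f_ℓ)` such
that every `f_i` contains, with nonzero coefficient, a monomial with at least `d` distinct
variables. -/
def IsNontrivialClass {F : Type u} [Field F] {m ℓ : ℕ} (d : ℕ)
    (𝓕 : Set (Fin ℓ → MvPolynomial (Fin m) F)) : Prop :=
  ∃ f ∈ 𝓕, ∀ i, ∃ μ ∈ (f i).support, d ≤ μ.support.card

/-- The data `(Share, Eval, Rec)` of an `s`-server `F`-linear HSS scheme for a class `𝓕` of
`ℓ`-tuples of `m`-variate polynomials. The secrets are the `ℓ * m` field elements `x i k`, the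
output space is `F^ℓ`, output symbols are elements of `F`, and server `j` sends `outLen j` of them.
`Share` and `Rec` are linear; `Eval` is an arbitrary function of the target tuple, the server, and
all of the shares held by that server; `Rec` does not see the target tuple. -/
structure LinearHSS (F : Type u) [Field F] (s : ℕ) {m ℓ : ℕ}
    (𝓕 : Set (Fin ℓ → MvPolynomial (Fin m) F)) where
  /-- the space of random seeds -/
  R : Type u
  /-- the space of input shares -/
  Y : Type u
  [fintypeR : Fintype R]
  [addCommGroupR : AddCommGroup R]
  [moduleR : Module F R]
  [addCommGroupY : AddCommGroup Y]
  [moduleY : Module F Y]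
  /-- the number of symbols sent by each server -/
  outLen : Fin s → ℕ
  share : (F × R) →ₗ[F] (Fin s → Y)
  eval : 𝓕 → (j : Fin s) → (Fin ℓ → Fin m → Y) → (Fin (outLen j) → F)
  reconstruct : ((Σ j : Fin s, Fin (outLen j)) → F) →ₗ[F] (Fin ℓ → F)

namespace LinearHSS

attribute [instance] fintypeR addCommGroupR moduleR addCommGroupY moduleY

variable {F : Type u} [Field F] {s m ℓ : ℕ} {𝓕 : Set (Fin ℓ → MvPolynomial (Fin m) F)}

/-- All output symbols, for the target `f`, the secrets `x` and the random seeds `r`: every secret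
`x i k` is shared with its own seed `r i k`, and server `j` evaluates on the `j`-th shares. -/
def outputs (π : LinearHSS F s 𝓕) (f : 𝓕) (x : Fin ℓ → Fin m → F) (r : Fin ℓ → Fin m → π.R) :
    (Σ j : Fin s, Fin (π.outLen j)) → F :=
  fun p => π.eval f p.1 (fun i k => π.share (x i k, r i k) p.1) p.2

/-- Correctness: for all targets and secrets, with independent uniform seeds, `Rec` returns
`(f_1(x^{(1)}), …, f_ℓ(x^{(ℓ)}))` with probability one. -/
def IsCorrect (π : LinearHSS F s 𝓕) : Prop :=
  ∀ (f : 𝓕) (x : Fin ℓ → Fin m → F),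
    (PMF.uniformOfFintype (Fin ℓ → Fin m → π.R)).toOuterMeasure
      {r | π.reconstruct (π.outputs f x r) = fun i => MvPolynomial.eval (x i) (f.1 i)} = 1

/-- `t`-privacy: the joint distribution of the shares of any at most `t` servers, over a uniform
seed, does not depend on the secret. -/
def IsPrivate (π : LinearHSS F s 𝓕) (t : ℕ) : Prop :=
  ∀ T : Finset (Fin s), T.card ≤ t → ∀ x x' : F,
    (PMF.uniformOfFintype π.R).map (fun r => fun j : T => π.share (x, r) j) =
      (PMF.uniformOfFintype π.R).map (fun r => fun j : T => π.share (x', r) j)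

/-- The number of bits sent by all servers together. -/
def downloadCost (π : LinearHSS F s 𝓕) : ℝ :=
  ∑ j : Fin s, (π.outLen j : ℝ) * Real.logb 2 (Nat.card F)

/-- The number of bits of the output space `F^ℓ`, divided by the download cost. -/
def downloadRate (π : LinearHSS F s 𝓕) : ℝ :=
  Real.logb 2 (Nat.card (Fin ℓ → F)) / π.downloadCost

/-- `G` is the matrix of `Rec`, when the downloaded symbols are listed (by `e`) as `z_1, …, z_n` in
such a way that `z_r` is sent by server `L r`. -/
def IsReconstructionMatrix (π : LinearHSS F s 𝓕) {n : ℕ} (G : Matrix (Fin ℓ) (Fin n) F)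
    (L : Fin n → Fin s) : Prop :=
  ∃ e : Fin n ≃ (Σ j : Fin s, Fin (π.outLen j)), (∀ r, (e r).1 = L r) ∧
    ∀ z, π.reconstruct z = G.mulVec (fun r => z (e r))

end LinearHSS

/-- The rate of a linear code. -/
def codeRate {F : Type u} [Field F] {n : ℕ} (C : Submodule F (Fin n → F)) : ℝ :=
  (Module.finrank F C : ℝ) / n

/-- `G`, with `ℓ` rows, is a generator matrix of `C`: the dimension of `C` is `ℓ` and `C` is the row
span of `G`. -/
def IsGeneratorMatrix {F : Type u} [Field F] {ℓ n : ℕ} (G : Matrix (Fin ℓ) (Fin n) F)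
    (C : Submodule F (Fin n → F)) : Prop :=
  Module.finrank F C = ℓ ∧ C = Submodule.span F (Set.range G.row)

/-- The labelweight of a word: the number of distinct labels on its support. -/
def wordLabelweight {F : Type u} [Field F] {n s : ℕ} (L : Fin n → Fin s) (c : Fin n → F) : ℕ :=
  (L '' {i | c i ≠ 0}).ncard

/-- The labelweight of a code: the minimum labelweight of its nonzero words (used for nonzero codes
only). -/
def codeLabelweight {F : Type u} [Field F] {n s : ℕ} (L : Fin n → Fin s)
    (C : Submodule F (Fin n → F)) : ℕ :=
  sInf (wordLabelweight L '' {c | c ∈ C ∧ c ≠ 0})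

end

/-! Both directions reduce to one condition on a pair (G, L): every combination uG with u ≠ 0 has
labelweight above dt. Necessity (`lt_wordLabelweight_vecMul`): suppose uG involves at most dt
servers, and let K be the variables of a monomial of f_{i₀} with |K| ≥ d, where u_{i₀} ≠ 0.
Distribute these servers over K, at most t per variable. By privacy, 1 has a sharing that the
servers of variable k cannot tell from the zero sharing of 0, so they do not notice x_k changing
from 0 to 1. In the alternating sum over the cube {0,1}^K every downloaded symbol cancels, whatever
`eval` is, yet the sum of the true outputs is, up to sign, u_{i₀} times a nonzero coefficient.
Sufficiency (`cnfScheme`): under CNF sharing, a monomial of degree at most d in the additive shares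
is computable by all but a set U of at most dt servers. Deleting the columns of G labelled in U
leaves full row rank, so G has a right inverse supported off U. Its columns are the weights with
which the other servers send the monomial. -/

open MvPolynomial

/-! ### Labelweights, generator matrices and right inverses. -/

section Labelweight

variable {F : Type*} [Field F] {ℓ n s : ℕ}

theorem codeLabelweight_le_wordLabelweight {L : Fin n → Fin s} {C : Submodule F (Fin n → F)}
    {c : Fin n → F} (hc : c ∈ C) (hc0 : c ≠ 0) : codeLabelweight L C ≤ wordLabelweight L c :=
  Nat.sInf_le ⟨c, ⟨hc, hc0⟩, rfl⟩

theorem exists_wordLabelweight_eq_codeLabelweight (L : Fin n → Fin s)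
    {C : Submodule F (Fin n → F)} (hC : C ≠ ⊥) :
    ∃ c ∈ C, c ≠ 0 ∧ wordLabelweight L c = codeLabelweight L C := by
  obtain ⟨c, hc, hc0⟩ := C.ne_bot_iff.1 hC
  obtain ⟨c', ⟨h1, h2⟩, h3⟩ :=
    Nat.sInf_mem (s := wordLabelweight L '' {c | c ∈ C ∧ c ≠ 0}) ⟨_, c, ⟨hc, hc0⟩, rfl⟩
  exact ⟨c', h1, h2, h3⟩

theorem wordLabelweight_comp_le {s' : ℕ} (g : Fin s → Fin s') (L : Fin n → Fin s) (c : Fin n → F) :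
    wordLabelweight (g ∘ L) c ≤ wordLabelweight L c := by
  unfold wordLabelweight
  rw [Set.image_comp]
  exact Set.ncard_image_le (Set.toFinite _)

theorem codeLabelweight_comp_le {s' : ℕ} (g : Fin s → Fin s') (L : Fin n → Fin s)
    (C : Submodule F (Fin n → F)) : codeLabelweight (g ∘ L) C ≤ codeLabelweight L C := by
  -- For the zero code the labelweight is `sInf ∅ = 0`.
  by_cases hC : C = ⊥
  · have hempty : {c | c ∈ C ∧ c ≠ 0} = ∅ := by
      ext c
      simp [hC]
    simp [codeLabelweight, hempty]
  · obtain ⟨c, hc, hc0, hcw⟩ := exists_wordLabelweight_eq_codeLabelweight L hC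
    rw [← hcw]
    exact (codeLabelweight_le_wordLabelweight hc hc0).trans (wordLabelweight_comp_le g L c)

theorem wordLabelweight_zero (L : Fin n → Fin s) : wordLabelweight L (0 : Fin n → F) = 0 := by
  simp [wordLabelweight]

theorem wordLabelweight_le_card_of_subset {L : Fin n → Fin s} {c : Fin n → F}
    {U : Finset (Fin s)} (h : ∀ r, c r ≠ 0 → L r ∈ U) : wordLabelweight L c ≤ U.card := by
  rw [← Set.ncard_coe_finset]
  refine Set.ncard_le_ncard ?_ (Set.toFinite _)
  rintro _ ⟨r, hr, rfl⟩
  exact h r hr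

theorem wordLabelweight_le (L : Fin n → Fin s) (c : Fin n → F) : wordLabelweight L c ≤ s := by
  simpa using wordLabelweight_le_card_of_subset (L := L) (c := c) (U := Finset.univ) (by simp)

/-- If there are at least as many coordinates as labels, every labeling is a coarsening of a
surjective one. -/
theorem exists_surjective_labeling_comp (hsn : s ≤ n) (L : Fin n → Fin s) :
    ∃ (L' : Fin n → Fin s) (g : Fin s → Fin s), Function.Surjective L' ∧ L = g ∘ L' := by
  classical
  -- `B` contains one coordinate for each label that occurs. It is enlarged to `A` with exactly `s`
  -- elements; these get distinct new labels, and every other coordinate copies its representative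
  -- in `B`.
  have hB : ∃ B : Finset (Fin n), B.card ≤ s ∧ ∀ r, ∃ q ∈ B, L q = L r := by
    obtain ⟨B, -, hB1, hB2⟩ := Finset.exists_subset_injOn_image_eq_of_surjOn
      (Finset.univ : Finset (Fin n)) (Finset.univ.image L) (f := L) (by intro y hy; simpa using hy)
    refine ⟨B, ?_, fun r => ?_⟩
    · rw [← Finset.card_image_of_injOn hB1]
      simpa using Finset.card_le_univ (B.image L)
    · have : L r ∈ B.image L := by rw [hB2]; simp
      simpa using this
  obtain ⟨B, hBs, hB⟩ := hB
  obtain ⟨A, hBA, hA⟩ := Finset.exists_superset_card_eq hBs (by simpa using hsn)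
  choose q hqB hq using hB
  let e : A ≃ Fin s := A.equivFinOfCardEq hA
  refine ⟨fun r => if h : r ∈ A then e ⟨r, h⟩ else e ⟨q r, hBA (hqB r)⟩, fun j => L (e.symm j),
    fun j => ⟨e.symm j, by simp⟩, ?_⟩
  funext r
  by_cases h : r ∈ A <;> simp [h, hq]

/-- If all nonzero combinations of the rows of `G` have labelweight more than `k`, then `G` has a
right inverse that vanishes on the coordinates whose label is in a prescribed `k`-set. -/
theorem exists_right_inverse_eq_zero_of_label_mem {k : ℕ} {G : Matrix (Fin ℓ) (Fin n) F}
    {L : Fin n → Fin s} (hG : ∀ u, u ≠ 0 → k < wordLabelweight L (Matrix.vecMul u G))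
    (U : Finset (Fin s)) (hU : U.card ≤ k) :
    ∃ H : Matrix (Fin n) (Fin ℓ) F, G * H = 1 ∧ ∀ r i, L r ∈ U → H r i = 0 := by
  classical
  -- Multiplying by `D` on the right erases the columns labelled in `U`. A vector u killed by `G *
  -- D` would make uG supported on `U`, against `hG`.
  let D : Matrix (Fin n) (Fin n) F := Matrix.diagonal fun r => if L r ∈ U then 0 else 1
  have hker : LinearMap.ker (G * D).vecMulLinear = ⊥ := by
    rw [LinearMap.ker_eq_bot']
    intro u hu
    by_contra hu0
    refine absurd (hG u hu0) (not_lt.2 ((wordLabelweight_le_card_of_subset fun r hr => ?_).trans hU))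
    by_contra hrU
    have := congrFun hu r
    rw [Matrix.vecMulLinear_apply, ← Matrix.vecMul_vecMul, Matrix.vecMul_diagonal] at this
    simp [hrU] at this
    exact hr this
  obtain ⟨g, hg⟩ := LinearMap.exists_leftInverse_of_injective _ hker
  let K : Matrix (Fin n) (Fin ℓ) F := (LinearMap.toMatrix' g).transpose
  have hK : ∀ w, Matrix.vecMul w K = g w := by
    intro w
    rw [Matrix.vecMul_transpose, ← Matrix.toLin'_apply, Matrix.toLin'_toMatrix']
  refine ⟨D * K, ?_, fun r i hr => by simp [D, Matrix.diagonal_mul, hr]⟩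
  rw [← Matrix.mul_assoc]
  refine Matrix.ext_of_single_vecMul ?_
  intro i
  rw [← Matrix.vecMul_vecMul, hK, Matrix.vecMul_one]
  exact LinearMap.congr_fun hg _

theorem IsGeneratorMatrix.vecMul_mem {G : Matrix (Fin ℓ) (Fin n) F} {C : Submodule F (Fin n → F)}
    (h : IsGeneratorMatrix G C) (u : Fin ℓ → F) : Matrix.vecMul u G ∈ C := by
  rw [h.2, Matrix.vecMul_eq_sum]
  exact Submodule.sum_mem _ fun i _ => Submodule.smul_mem _ _ (Submodule.subset_span ⟨i, rfl⟩)

theorem IsGeneratorMatrix.vecMul_ne_zero {G : Matrix (Fin ℓ) (Fin n) F}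
    {C : Submodule F (Fin n → F)} (h : IsGeneratorMatrix G C) {u : Fin ℓ → F} (hu : u ≠ 0) :
    Matrix.vecMul u G ≠ 0 := by
  have hli : LinearIndependent F G.row := by
    rw [linearIndependent_iff_card_eq_finrank_span, Set.finrank, ← h.2, h.1, Fintype.card_fin]
  rw [← Matrix.vecMul_injective_iff] at hli
  exact fun h0 => hu (hli (by simpa using h0))

theorem IsGeneratorMatrix.of_vecMul_ne_zero {G : Matrix (Fin ℓ) (Fin n) F}
    (h : ∀ u, u ≠ 0 → Matrix.vecMul u G ≠ 0) :
    IsGeneratorMatrix G (Submodule.span F (Set.range G.row)) := by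
  refine ⟨?_, rfl⟩
  have hli : LinearIndependent F G.row := by
    rw [← Matrix.vecMul_injective_iff]
    refine (injective_iff_map_eq_zero G.vecMulLinear).2 fun u hu => ?_
    by_contra hu0
    exact h u hu0 hu
  simpa using finrank_span_eq_card hli

theorem exists_isGeneratorMatrix {C : Submodule F (Fin n → F)} (hC : Module.finrank F C = ℓ) :
    ∃ G : Matrix (Fin ℓ) (Fin n) F, IsGeneratorMatrix G C := by
  let b := Module.finBasisOfFinrankEq F C hC
  refine ⟨Matrix.of fun i => (b i : Fin n → F), hC, ?_⟩
  have : Set.range (Matrix.of fun i => (b i : Fin n → F)).row = C.subtype '' Set.range b := by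
    rw [← Set.range_comp]; rfl
  rw [this, Submodule.span_image, b.span_eq, Submodule.map_top, Submodule.range_subtype]

theorem codeRate_eq_div_iff (hn : 0 < n) {C : Submodule F (Fin n → F)} :
    codeRate C = (ℓ : ℝ) / n ↔ Module.finrank F C = ℓ := by
  have : (n : ℝ) ≠ 0 := by positivity
  rw [codeRate, div_left_inj' this, Nat.cast_inj]

/-- A generator matrix of a code of labelweight more than `k`, in terms of combinations of rows. -/
theorem IsGeneratorMatrix.lt_codeLabelweight_iff {k : ℕ} {G : Matrix (Fin ℓ) (Fin n) F}
    {C : Submodule F (Fin n → F)} {L : Fin n → Fin s} (h : IsGeneratorMatrix G C) (hℓ : 0 < ℓ) :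
    k < codeLabelweight L C ↔ ∀ u, u ≠ 0 → k < wordLabelweight L (Matrix.vecMul u G) := by
  constructor
  · exact fun hk u hu => hk.trans_le
      (codeLabelweight_le_wordLabelweight (h.vecMul_mem u) (h.vecMul_ne_zero hu))
  · intro hk
    have hC : C ≠ ⊥ := by
      rintro rfl
      have := h.1
      simp at this
      omega
    obtain ⟨c, hc, hc0, hcw⟩ := exists_wordLabelweight_eq_codeLabelweight L hC
    rw [← hcw]
    have : c ∈ LinearMap.range G.vecMulLinear := by
      rw [range_vecMulLinear, ← h.2]
      exact hc
    obtain ⟨u, rfl⟩ := this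
    refine hk u ?_
    rintro rfl
    simp at hc0

end Labelweight

/-! ### Isolating a coefficient by alternating sums over a cube. -/

theorem Finsupp.card_support_le_sum {α : Type*} (ν : α →₀ ℕ) : ν.support.card ≤ ν.sum fun _ e => e := by
  rw [Finset.card_eq_sum_ones]
  exact Finset.sum_le_sum fun k hk => Nat.one_le_iff_ne_zero.2 (Finsupp.mem_support_iff.1 hk)

/-- The degree bounds force equal supports and then all exponents on them to be 1. Hence no other
monomial of a polynomial of such low degree involves all variables of `μ`. -/
theorem Finsupp.eq_of_support_subset_of_sum_le {α : Type*} {μ ν : α →₀ ℕ} (hs : μ.support ⊆ ν.support)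
    (hμ : (μ.sum fun _ e => e) ≤ μ.support.card) (hν : (ν.sum fun _ e => e) ≤ μ.support.card) :
    ν = μ := by
  have hsupp : μ.support = ν.support :=
    Finset.eq_of_subset_of_card_le hs ((Finsupp.card_support_le_sum ν).trans hν)
  have key : ∀ κ : α →₀ ℕ, (κ.sum fun _ e => e) ≤ κ.support.card → ∀ k ∈ κ.support, κ k = 1 := by
    intro κ hκ k hk
    have h1 : ∀ i ∈ κ.support, 1 ≤ κ i :=
      fun i hi => Nat.one_le_iff_ne_zero.2 (Finsupp.mem_support_iff.1 hi)
    refine (((Finset.sum_eq_sum_iff_of_le h1).1 ?_) k hk).symm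
    rw [← Finset.card_eq_sum_ones]
    exact le_antisymm (Finsupp.card_support_le_sum κ) hκ
  ext k
  by_cases hk : k ∈ μ.support
  · rw [key μ hμ k hk, key ν (hsupp ▸ hν) k (hsupp ▸ hk)]
  · rw [Finsupp.notMem_support_iff.1 hk, Finsupp.notMem_support_iff.1 (hsupp ▸ hk)]

section AlternatingSum

variable {α R : Type*} [DecidableEq α] [CommRing R]

/-- The terms of `A` and `insert a A` cancel in pairs. -/
theorem sum_powerset_neg_one_pow_mul_eq_zero {K : Finset α} {a : α} (ha : a ∈ K)
    {g : Finset α → R} (hg : ∀ A, g (insert a A) = g A) :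
    ∑ A ∈ K.powerset, (-1) ^ A.card * g A = 0 := by
  rw [← Finset.insert_erase ha, Finset.sum_powerset_insert (Finset.notMem_erase a K),
    ← Finset.sum_add_distrib]
  refine Finset.sum_eq_zero fun A hA => ?_
  have : a ∉ A := fun h => Finset.notMem_erase a K (Finset.mem_powerset.1 hA h)
  rw [Finset.card_insert_of_notMem this, hg]
  ring

/-- For a polynomial of total degree at most the number of variables of one of its monomials, the
alternating sum over the corresponding subcube is, up to sign, the coefficient of that monomial. -/
theorem sum_powerset_neg_one_pow_mul_eval {f : MvPolynomial α R} {μ : α →₀ ℕ} (hμ : μ ∈ f.support)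
    (hf : f.totalDegree ≤ μ.support.card) :
    ∑ A ∈ μ.support.powerset, (-1) ^ A.card * eval (fun k => if k ∈ A then 1 else 0) f =
      (-1) ^ μ.support.card * coeff μ f := by
  -- At a 0/1 point, a monomial is the indicator of its support being contained in `A`. So `μ`
  -- survives only at the full set, and any other monomial misses a variable of `μ` and cancels.
  have hmon : ∀ (A : Finset α) (ν : α →₀ ℕ),
      ∏ k ∈ ν.support, (if k ∈ A then (1 : R) else 0) ^ ν k = if ν.support ⊆ A then 1 else 0 := by
    intro A ν
    split_ifs with h
    · exact Finset.prod_eq_one fun k hk => by simp [h hk]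
    · obtain ⟨k, hk, hkA⟩ := Finset.not_subset.1 h
      exact Finset.prod_eq_zero hk (by simp [hkA, Finsupp.mem_support_iff.1 hk])
  have hdeg : ∀ ν ∈ f.support, (ν.sum fun _ e => e) ≤ μ.support.card :=
    fun ν hν => (le_totalDegree hν).trans hf
  simp_rw [eval_eq, hmon, Finset.mul_sum]
  rw [Finset.sum_comm, Finset.sum_eq_single_of_mem μ hμ]
  · rw [Finset.sum_eq_single_of_mem μ.support (by simp)]
    · simp
    · intro A hA hne
      have : ¬ μ.support ⊆ A := fun h => hne ((Finset.mem_powerset.1 hA).antisymm h)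
      simp [this]
  · intro ν hν hne
    by_cases hsub : μ.support ⊆ ν.support
    · exact absurd (Finsupp.eq_of_support_subset_of_sum_le hsub (hdeg μ hμ) (hdeg ν hν)) hne
    · obtain ⟨k, hk, hkν⟩ := Finset.not_subset.1 hsub
      refine sum_powerset_neg_one_pow_mul_eq_zero hk fun A => ?_
      simp only [Finset.subset_insert_iff_of_notMem hkν]

end AlternatingSum

/-! ### Necessity: what correctness and privacy force on the reconstruction matrix. -/

namespace LinearHSS

universe u

variable {F : Type u} [Field F] {s m ℓ n t d : ℕ} {𝓕 : Set (Fin ℓ → MvPolynomial (Fin m) F)}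

/-- The uniform distribution has full support, so probability one means every seed. -/
theorem isCorrect_iff (π : LinearHSS F s 𝓕) :
    π.IsCorrect ↔ ∀ (f : 𝓕) (x : Fin ℓ → Fin m → F) (r : Fin ℓ → Fin m → π.R),
      π.reconstruct (π.outputs f x r) = fun i => MvPolynomial.eval (x i) (f.1 i) := by
  refine forall_congr' fun f => forall_congr' fun x => ?_
  rw [PMF.toOuterMeasure_apply_eq_one_iff, PMF.support_uniformOfFintype]
  exact ⟨fun h r => h (Set.mem_univ r), fun h r _ => h r⟩

/-- Privacy provides sharings of `1` with all shares in a given `t`-set equal to zero. -/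
theorem IsPrivate.exists_share_one_eq_zero {π : LinearHSS F s 𝓕} (h : π.IsPrivate t)
    {T : Finset (Fin s)} (hT : T.card ≤ t) : ∃ ρ : π.R, ∀ j ∈ T, π.share (1, ρ) j = 0 := by
  -- By linearity, secret 0 with seed 0 yields the all-zero view, which by privacy must also occur
  -- for secret 1.
  have h0 : (fun j : T => π.share (0, 0) j) ∈
      ((PMF.uniformOfFintype π.R).map fun r => fun j : T => π.share (0, r) j).support :=
    (PMF.mem_support_map_iff _ _ _).2 ⟨0, PMF.mem_support_uniformOfFintype _, rfl⟩
  rw [h T hT 0 1, PMF.mem_support_map_iff] at h0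
  obtain ⟨ρ, -, hρ⟩ := h0
  refine ⟨ρ, fun j hj => (congrFun hρ ⟨j, hj⟩).trans ?_⟩
  change π.share 0 j = 0
  rw [map_zero, Pi.zero_apply]

theorem dotProduct_reconstruct {π : LinearHSS F s 𝓕}
    {G : Matrix (Fin ℓ) (Fin n) F} {e : Fin n ≃ Σ j : Fin s, Fin (π.outLen j)}
    (hG : ∀ z, π.reconstruct z = G.mulVec fun r => z (e r)) (u : Fin ℓ → F)
    (z : (Σ j : Fin s, Fin (π.outLen j)) → F) :
    u ⬝ᵥ π.reconstruct z = ∑ r, Matrix.vecMul u G r * z (e r) := by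
  rw [hG, Matrix.dotProduct_mulVec]
  rfl

/-- The key lower bound: in a correct and `t`-private scheme for a non-trivial class, every nonzero
combination of the outputs has to involve more than `d * t` servers. -/
theorem lt_wordLabelweight_vecMul {π : LinearHSS F s 𝓕} (hd : 0 < d)
    (h𝓕 : 𝓕 ⊆ PolyClassPow F d m ℓ) (hnt : IsNontrivialClass d 𝓕) (hcorr : π.IsCorrect)
    (hpriv : π.IsPrivate t) {G : Matrix (Fin ℓ) (Fin n) F} {L : Fin n → Fin s}
    (hGL : π.IsReconstructionMatrix G L) {u : Fin ℓ → F} (hu : u ≠ 0) :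
    d * t < wordLabelweight L (Matrix.vecMul u G) := by
  classical
  by_contra! hle
  obtain ⟨e, he, hG⟩ := hGL
  obtain ⟨f, hf, hmon⟩ := hnt
  obtain ⟨i₀, hi₀⟩ := Function.ne_iff.1 hu
  obtain ⟨μ, hμ, hdμ⟩ := hmon i₀
  set K := μ.support with hK
  -- The first coordinate of the embedding `p` assigns a variable of `K` to each involved server;
  -- the factor `Fin t` bounds each group by `t`.
  have hcard : Fintype.card (L '' {r | Matrix.vecMul u G r ≠ 0}) ≤ Fintype.card (K × Fin t) := by
    rw [← Nat.card_eq_fintype_card, Fintype.card_prod, Fintype.card_coe, Fintype.card_fin]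
    exact hle.trans (Nat.mul_le_mul_right t hdμ)
  obtain ⟨p⟩ := Function.Embedding.nonempty_of_card_le hcard
  let part : Fin m → Finset (Fin s) := fun k =>
    Finset.univ.filter fun j => ∃ h : j ∈ L '' {r | Matrix.vecMul u G r ≠ 0}, (p ⟨j, h⟩).1 = k
  have hpart : ∀ k, (part k).card ≤ t := by
    intro k
    have hmem : ∀ j : part k, ∃ h : j.1 ∈ L '' {r | Matrix.vecMul u G r ≠ 0}, (p ⟨j, h⟩).1 = k :=
      fun j => (Finset.mem_filter.1 j.2).2
    choose h1 h2 using hmem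
    have := Fintype.card_le_of_injective (fun j : part k => (p ⟨j, h1 j⟩).2) fun j j' hjj => by
      have h3 : p ⟨j, h1 j⟩ = p ⟨j', h1 j'⟩ :=
        Prod.ext (Subtype.ext ((h2 j).trans (h2 j').symm)) hjj
      exact Subtype.ext (congrArg (fun y => y.1) (p.injective h3))
    simpa using this
  choose ρ hρ using fun k => hpriv.exists_share_one_eq_zero (hpart k)
  let x : Finset (Fin m) → Fin ℓ → Fin m → F := fun A i k => if i = i₀ ∧ k ∈ A then 1 else 0
  -- Ones are shared with `ρ k`, zeros with seed 0, so the servers in `part k` hold 0 in either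
  -- case.
  let seed : Finset (Fin m) → Fin ℓ → Fin m → π.R := fun A i k =>
    if i = i₀ ∧ k ∈ A then ρ k else 0
  have hout : ∀ A, ∑ i, u i * MvPolynomial.eval (x A i) (f i) =
      ∑ r, Matrix.vecMul u G r * π.outputs ⟨f, hf⟩ (x A) (seed A) (e r) := by
    intro A
    rw [← dotProduct_reconstruct hG, π.isCorrect_iff.1 hcorr]
    rfl
  have hsum := congrArg (fun g : Finset (Fin m) → F => ∑ A ∈ K.powerset, (-1) ^ A.card * g A)
    (funext hout)
  simp only [Finset.mul_sum] at hsum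
  rw [Finset.sum_comm, Finset.sum_comm (s := K.powerset)] at hsum
  have hKne : K.Nonempty := Finset.card_pos.1 (hd.trans_le hdμ)
  have hright : ∀ r, ∑ A ∈ K.powerset, (-1) ^ A.card *
      (Matrix.vecMul u G r * π.outputs ⟨f, hf⟩ (x A) (seed A) (e r)) = 0 := by
    intro r
    by_cases hr : Matrix.vecMul u G r = 0
    · simp [hr]
    have hj : L r ∈ L '' {r | Matrix.vecMul u G r ≠ 0} := ⟨r, hr, rfl⟩
    have hk : L r ∈ part (p ⟨L r, hj⟩).1 := Finset.mem_filter.2 ⟨Finset.mem_univ _, hj, rfl⟩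
    -- Toggling the variable assigned to the server `L r` leaves all of its shares unchanged.
    refine sum_powerset_neg_one_pow_mul_eq_zero (p ⟨L r, hj⟩).1.2 fun A => ?_
    congr 1
    unfold outputs
    congr 1
    funext i k
    by_cases hik : i = i₀ ∧ k = (p ⟨L r, hj⟩).1
    · obtain ⟨rfl, rfl⟩ := hik
      have hzero : π.share (0, 0) (e r).1 = 0 := by
        change π.share 0 (e r).1 = 0
        rw [map_zero, Pi.zero_apply]
      have hone : π.share (1, ρ (p ⟨L r, hj⟩).1) (e r).1 = 0 := by
        rw [he]
        exact hρ _ _ hk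
      have hany : ∀ A : Finset (Fin m),
          π.share (x A i (p ⟨L r, hj⟩).1, seed A i (p ⟨L r, hj⟩).1) (e r).1 = 0 := by
        intro A
        by_cases hA : (p ⟨L r, hj⟩).1.1 ∈ A <;> simp [x, seed, hA, hzero, hone]
      rw [hany, hany]
    · have : (i = i₀ ∧ k ∈ insert (p ⟨L r, hj⟩).1.1 A) ↔ (i = i₀ ∧ k ∈ A) := by
        rw [Finset.mem_insert]
        tauto
      simp only [x, seed, this]
  -- Only the inputs of `f i₀` vary with `A`; constants cancel because `K` is nonempty, which needs
  -- `0 < d`.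
  have hleft : ∀ i, i ≠ i₀ → ∑ A ∈ K.powerset, (-1) ^ A.card * (u i * MvPolynomial.eval (x A i) (f i)) = 0 := by
    intro i hi
    obtain ⟨k, hk⟩ := hKne
    exact sum_powerset_neg_one_pow_mul_eq_zero hk fun A => by simp [x, hi]
  rw [Finset.sum_eq_zero fun r _ => hright r,
    Finset.sum_eq_single_of_mem i₀ (Finset.mem_univ _) fun i _ hi => hleft i hi] at hsum
  have halt := sum_powerset_neg_one_pow_mul_eval hμ ((h𝓕 hf i₀).trans hdμ)
  simp only [x, true_and, mul_left_comm _ (u i₀)] at hsum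
  rw [← Finset.mul_sum, halt] at hsum
  exact mul_ne_zero hi₀ (mul_ne_zero (pow_ne_zero _ (by simp)) (mem_support_iff.1 hμ)) hsum

theorem downloadRate_eq [Finite F] (π : LinearHSS F s 𝓕) :
    π.downloadRate = (ℓ : ℝ) / (∑ j, π.outLen j : ℕ) := by
  have hlog : Real.logb 2 (Nat.card F) ≠ 0 :=
    (Real.logb_pos (by norm_num) (by exact_mod_cast Finite.one_lt_card)).ne'
  have hcost : π.downloadCost = (∑ j, π.outLen j : ℕ) * Real.logb 2 (Nat.card F) := by
    rw [downloadCost, ← Finset.sum_mul, Nat.cast_sum]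
  rw [downloadRate, hcost, Nat.card_fun, Nat.cast_pow, Real.logb_pow, Nat.card_eq_fintype_card,
    Fintype.card_fin, mul_div_mul_right _ _ hlog]

theorem sum_outLen_eq [Finite F] {π : LinearHSS F s 𝓕} (hℓ : 0 < ℓ)
    (h : π.downloadRate = (ℓ : ℝ) / n) : ∑ j, π.outLen j = n := by
  have hℓ' : (ℓ : ℝ) ≠ 0 := by positivity
  rw [downloadRate_eq, div_eq_mul_inv, div_eq_mul_inv, mul_right_inj' hℓ', inv_inj] at h
  exact_mod_cast h

theorem exists_isReconstructionMatrix (π : LinearHSS F s 𝓕) (h : ∑ j, π.outLen j = n) :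
    ∃ (G : Matrix (Fin ℓ) (Fin n) F) (L : Fin n → Fin s), π.IsReconstructionMatrix G L := by
  classical
  let e : Fin n ≃ Σ j : Fin s, Fin (π.outLen j) := (Fintype.equivFinOfCardEq (by simpa using h)).symm
  refine ⟨LinearMap.toMatrix' (π.reconstruct ∘ₗ LinearMap.funLeft F F e.symm), fun r => (e r).1, e,
    fun _ => rfl, fun z => ?_⟩
  rw [LinearMap.toMatrix'_mulVec, LinearMap.comp_apply]
  congr 1
  funext q
  simp [LinearMap.funLeft_apply]

end LinearHSS

/-! ### Polynomials in additive shares. -/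

section Expansion

variable {σ τ F : Type*} [Field F]

theorem MvPolynomial.totalDegree_bind₁_le {g : σ → MvPolynomial τ F}
    (hg : ∀ k, (g k).totalDegree ≤ 1) (f : MvPolynomial σ F) :
    (bind₁ g f).totalDegree ≤ f.totalDegree := by
  rw [bind₁, aeval_def, eval₂_eq]
  refine totalDegree_finsetSum_le fun μ hμ => (totalDegree_mul _ _).trans ?_
  rw [algebraMap_eq, totalDegree_C, zero_add]
  refine le_trans ?_ (le_totalDegree hμ)
  refine (totalDegree_finsetProd _ _).trans (Finset.sum_le_sum fun k _ => ?_)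
  exact (totalDegree_pow _ _).trans (by simpa using Nat.mul_le_mul_left (μ k) (hg k))

/-- The polynomial `f` in additive shares of its variables: `X k` is replaced by `∑ T, X (k, T)`. -/
noncomputable def sharedPolynomial (τ : Type*) [Fintype τ] (f : MvPolynomial σ F) :
    MvPolynomial (σ × τ) F :=
  bind₁ (fun k => ∑ T : τ, X (k, T)) f

variable [Fintype τ]

theorem totalDegree_sharedPolynomial_le (f : MvPolynomial σ F) :
    (sharedPolynomial τ f).totalDegree ≤ f.totalDegree :=
  totalDegree_bind₁_le (fun _ => totalDegree_finsetSum_le fun _ _ => (totalDegree_X _).le) f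

theorem eval_sharedPolynomial (v : σ × τ → F) (f : MvPolynomial σ F) :
    eval v (sharedPolynomial τ f) = eval (fun k => ∑ T, v (k, T)) f := by
  rw [sharedPolynomial, eval, eval₂Hom_bind₁]
  congr 2
  funext k
  simp

end Expansion

/-! ### CNF sharing and its privacy. -/

/-- The index set of the additive shares in `t`-private CNF sharing among `s` servers. -/
abbrev CnfIndex (s t : ℕ) : Type := {T : Finset (Fin s) // T.card = t}

section Cnf

variable {F : Type*} [Field F] {s t : ℕ}

/-- Additive shares of a secret, indexed by the `t`-subsets of the servers; the share of `T₀` is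
corrected so that the sum is the secret. -/
noncomputable def additiveShare (T₀ : CnfIndex s t) :
    (F × (CnfIndex s t → F)) →ₗ[F] (CnfIndex s t → F) where
  toFun p := p.2 + (p.1 - ∑ T, p.2 T) • Pi.single T₀ 1
  map_add' p q := by
    ext T
    simp [Finset.sum_add_distrib]
    ring
  map_smul' c p := by
    ext T
    simp [← Finset.mul_sum]
    ring

theorem additiveShare_apply (T₀ : CnfIndex s t) (x : F) (w : CnfIndex s t → F) :
    additiveShare T₀ (x, w) = w + (x - ∑ T, w T) • Pi.single T₀ 1 := rfl

theorem sum_additiveShare (T₀ : CnfIndex s t) (p : F × (CnfIndex s t → F)) :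
    ∑ T, additiveShare T₀ p T = p.1 := by
  simp [additiveShare, Finset.sum_add_distrib, ← Finset.mul_sum]

/-- The change of the secret and the change of the seed sum offset each other in the correction term
at `T₀`, so only the share of `T'` moves, even if `T' = T₀`. -/
theorem additiveShare_sub_single (T₀ T' : CnfIndex s t) (x x' : F) (w : CnfIndex s t → F) :
    additiveShare T₀ (x', w - Pi.single T' (x - x')) =
      additiveShare T₀ (x, w) - Pi.single T' (x - x') := by
  have : ∑ T, (w - Pi.single T' (x - x') : CnfIndex s t → F) T = ∑ T, w T - (x - x') := by
    simp
  rw [additiveShare_apply, additiveShare_apply, this]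
  ext T
  simp
  ring

/-- CNF sharing: server `j` gets all the additive shares whose index does not contain `j`. -/
noncomputable def cnfShare (T₀ : CnfIndex s t) :
    (F × (CnfIndex s t → F)) →ₗ[F] (Fin s → CnfIndex s t → F) :=
  LinearMap.pi fun j => LinearMap.pi fun T =>
    if j ∈ T.1 then 0 else LinearMap.proj T ∘ₗ additiveShare T₀

theorem cnfShare_apply (T₀ : CnfIndex s t) (p : F × (CnfIndex s t → F)) (j : Fin s)
    (T : CnfIndex s t) :
    cnfShare T₀ p j T = if j ∈ T.1 then 0 else additiveShare T₀ p T := by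
  by_cases h : j ∈ T.1 <;> simp [cnfShare, h]

/-- The servers in `T'` do not hold the one share that moves. -/
theorem cnfShare_sub_single (T₀ T' : CnfIndex s t) (x x' : F) (w : CnfIndex s t → F) {j : Fin s}
    (hj : j ∈ T'.1) :
    cnfShare T₀ (x', w - Pi.single T' (x - x')) j = cnfShare T₀ (x, w) j := by
  funext T
  rw [cnfShare_apply, cnfShare_apply]
  split_ifs with h
  · rfl
  · have : T ≠ T' := by rintro rfl; exact h hj
    rw [additiveShare_sub_single, Pi.sub_apply, Pi.single_eq_of_ne this, sub_zero]

theorem PMF.map_uniformOfFintype_equiv {α : Type*} [Fintype α] [Nonempty α] (e : α ≃ α) :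
    (PMF.uniformOfFintype α).map e = PMF.uniformOfFintype α := by
  classical
  ext a
  rw [PMF.map_apply, tsum_eq_single (e.symm a)]
  · simp
  · intro b hb
    rw [if_neg]
    rintro rfl
    simp at hb

end Cnf

section Labels

variable {n s : ℕ}

/-- The coordinates of a labeling, listed label by label. -/
noncomputable def labelEquiv (L : Fin n → Fin s) :
    Fin n ≃ Σ j : Fin s, Fin (Fintype.card {r // L r = j}) :=
  (Equiv.sigmaFiberEquiv L).symm.trans (Equiv.sigmaCongrRight fun _ => Fintype.equivFin _)

end Labels

/-- The union of the index sets of the additive shares that occur in a monomial. -/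
def monomialServers {m s t : ℕ} (μ : Fin m × CnfIndex s t →₀ ℕ) : Finset (Fin s) :=
  μ.support.biUnion fun p => p.2.1

theorem card_monomialServers_le {m s t : ℕ} (μ : Fin m × CnfIndex s t →₀ ℕ) :
    (monomialServers μ).card ≤ (μ.sum fun _ e => e) * t :=
  (Finset.card_biUnion_le_card_mul _ _ t fun p _ => p.2.2.le).trans
    (Nat.mul_le_mul_right t (Finsupp.card_support_le_sum μ))

/-! ### Sufficiency: the scheme built from a code. -/

namespace LinearHSS

universe u

variable {F : Type u} [Field F] [Finite F] {s m ℓ n t d : ℕ}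

/-- The scheme with CNF sharing in which the symbol at coordinate `r` is the combination, with
weights `H U r i`, of the monomials of the `i`-th polynomial in the additive shares, where `U` is
the set of servers missing some share of the monomial. -/
noncomputable def cnfScheme (𝓕 : Set (Fin ℓ → MvPolynomial (Fin m) F)) (T₀ : CnfIndex s t)
    (G : Matrix (Fin ℓ) (Fin n) F) (L : Fin n → Fin s)
    (H : Finset (Fin s) → Matrix (Fin n) (Fin ℓ) F) : LinearHSS F s 𝓕 where
  R := CnfIndex s t → F
  Y := CnfIndex s t → F
  fintypeR := Fintype.ofFinite _
  outLen j := Fintype.card {r // L r = j}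
  share := cnfShare T₀
  eval f j y c := ∑ i, ∑ μ ∈ (sharedPolynomial (CnfIndex s t) (f.1 i)).support,
    H (monomialServers μ) ((labelEquiv L).symm ⟨j, c⟩) i *
      (coeff μ (sharedPolynomial (CnfIndex s t) (f.1 i)) *
        ∏ p ∈ μ.support, y i p.1 p.2 ^ μ p)
  reconstruct := G.mulVecLin ∘ₗ LinearMap.funLeft F F (labelEquiv L)

variable {𝓕 : Set (Fin ℓ → MvPolynomial (Fin m) F)} {T₀ : CnfIndex s t}
  {G : Matrix (Fin ℓ) (Fin n) F} {L : Fin n → Fin s}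
  {H : Finset (Fin s) → Matrix (Fin n) (Fin ℓ) F}

theorem isReconstructionMatrix_cnfScheme : (cnfScheme 𝓕 T₀ G L H).IsReconstructionMatrix G L :=
  ⟨labelEquiv L, fun _ => rfl, fun _ => rfl⟩

theorem downloadRate_cnfScheme : (cnfScheme 𝓕 T₀ G L H).downloadRate = (ℓ : ℝ) / n := by
  have : ∑ j, (cnfScheme 𝓕 T₀ G L H).outLen j = n := by
    change ∑ j, Fintype.card {r // L r = j} = n
    simpa using (Fintype.card_congr (labelEquiv L)).symm
  rw [downloadRate_eq, this]

/-- Enlarge `T` to a `t`-set `T'`. Translating the seed at `T'` is a bijection that matches the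
views of the two secrets. -/
theorem isPrivate_cnfScheme : (cnfScheme 𝓕 T₀ G L H).IsPrivate t := by
  intro T hT x x'
  have hts : t ≤ Fintype.card (Fin s) := T₀.2 ▸ Finset.card_le_univ _
  obtain ⟨T', hTT', hT'⟩ := Finset.exists_superset_card_eq hT hts
  let _ : Fintype (CnfIndex s t → F) := Fintype.ofFinite _
  let e : (CnfIndex s t → F) ≃ (CnfIndex s t → F) :=
    Equiv.subRight (Pi.single ⟨T', hT'⟩ (x - x'))
  change (PMF.uniformOfFintype (CnfIndex s t → F)).map (fun r => fun j : T => cnfShare T₀ (x, r) j) =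
    (PMF.uniformOfFintype (CnfIndex s t → F)).map (fun r => fun j : T => cnfShare T₀ (x', r) j)
  conv_rhs => rw [← PMF.map_uniformOfFintype_equiv e, PMF.map_comp]
  congr 1
  funext r j
  exact (cnfShare_sub_single T₀ ⟨T', hT'⟩ x x' r (hTT' j.2)).symm

theorem isCorrect_cnfScheme (h𝓕 : 𝓕 ⊆ PolyClassPow F d m ℓ)
    (hGH : ∀ U : Finset (Fin s), U.card ≤ d * t → G * H U = 1)
    (hH : ∀ U : Finset (Fin s), U.card ≤ d * t → ∀ r i, L r ∈ U → H U r i = 0) :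
    (cnfScheme 𝓕 T₀ G L H).IsCorrect := by
  rw [isCorrect_iff]
  intro f x r
  let v : Fin ℓ → Fin m × CnfIndex s t → F := fun i p => additiveShare T₀ (x i p.1, r i p.1) p.2
  let P : Fin ℓ → MvPolynomial (Fin m × CnfIndex s t) F := fun i => sharedPolynomial _ (f.1 i)
  have hU : ∀ i, ∀ μ ∈ (P i).support, (monomialServers μ).card ≤ d * t := fun i μ hμ =>
    (card_monomialServers_le μ).trans (Nat.mul_le_mul_right t ((le_totalDegree hμ).trans
      ((totalDegree_sharedPolynomial_le _).trans (h𝓕 f.2 i))))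
  have hout : ∀ q, (cnfScheme 𝓕 T₀ G L H).outputs f x r (labelEquiv L q) =
      ∑ i, ∑ μ ∈ (P i).support, H (monomialServers μ) q i *
        (coeff μ (P i) * ∏ p ∈ μ.support, v i p ^ μ p) := by
    intro q
    change ∑ i, ∑ μ ∈ (P i).support, H (monomialServers μ) ((labelEquiv L).symm (labelEquiv L q)) i *
      (coeff μ (P i) * ∏ p ∈ μ.support, cnfShare T₀ (x i p.1, r i p.1) (L q) p.2 ^ μ p) = _
    rw [Equiv.symm_apply_apply]
    refine Finset.sum_congr rfl fun i _ => Finset.sum_congr rfl fun μ hμ => ?_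
    -- A missing share is replaced by 0 in `cnfShare`; this is harmless, as the weight of the whole
    -- monomial vanishes there.
    by_cases hq : L q ∈ monomialServers μ
    · rw [hH _ (hU i μ hμ) q i hq, zero_mul, zero_mul]
    · congr 2
      refine Finset.prod_congr rfl fun p hp => ?_
      have : L q ∉ p.2.1 := fun h => hq (Finset.mem_biUnion.2 ⟨p, hp, h⟩)
      rw [cnfShare_apply, if_neg this]
  have hrec : (cnfScheme 𝓕 T₀ G L H).reconstruct ((cnfScheme 𝓕 T₀ G L H).outputs f x r) =
      G.mulVec fun q => (cnfScheme 𝓕 T₀ G L H).outputs f x r (labelEquiv L q) := rfl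
  rw [hrec]
  funext i'
  simp only [hout, Matrix.mulVec, dotProduct, Finset.mul_sum]
  rw [Finset.sum_comm]
  have hterm : ∀ i, ∑ q, ∑ μ ∈ (P i).support, G i' q * (H (monomialServers μ) q i *
      (coeff μ (P i) * ∏ p ∈ μ.support, v i p ^ μ p)) =
        if i' = i then MvPolynomial.eval (x i) (f.1 i) else 0 := by
    intro i
    have hx : x i = fun k => ∑ T, v i (k, T) := by
      funext k
      simp only [v, sum_additiveShare]
    rw [Finset.sum_comm]
    conv_rhs => rw [hx, ← eval_sharedPolynomial, eval_eq]
    have hone : ∀ μ ∈ (P i).support, ∑ q, G i' q * (H (monomialServers μ) q i *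
        (coeff μ (P i) * ∏ p ∈ μ.support, v i p ^ μ p)) =
          (if i' = i then 1 else 0) * (coeff μ (P i) * ∏ p ∈ μ.support, v i p ^ μ p) := by
      intro μ hμ
      -- `G * H U = 1` delivers each monomial of the `i`-th polynomial to output `i` and to no
      -- other.
      rw [← Matrix.one_apply, ← hGH _ (hU i μ hμ), Matrix.mul_apply, Finset.sum_mul]
      simp only [mul_assoc]
    rw [Finset.sum_congr rfl hone, ← Finset.mul_sum, ite_mul, one_mul, zero_mul]
  rw [Finset.sum_congr rfl fun i _ => hterm i]
  simp

/-- Existence of a scheme with a prescribed reconstruction pair. -/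
theorem exists_isReconstructionMatrix_of_lt_wordLabelweight (hd : 0 < d) (hℓ : 0 < ℓ)
    (h𝓕 : 𝓕 ⊆ PolyClassPow F d m ℓ)
    (hG : ∀ u, u ≠ 0 → d * t < wordLabelweight L (Matrix.vecMul u G)) :
    ∃ π : LinearHSS F s 𝓕, π.IsCorrect ∧ π.IsPrivate t ∧ π.downloadRate = (ℓ : ℝ) / n ∧
      π.IsReconstructionMatrix G L := by
  -- CNF sharing needs a `t`-subset of the servers. It exists because a row of `G` has labelweight
  -- above dt ≥ t and at most `s`.
  have hts : t ≤ (Finset.univ : Finset (Fin s)).card := by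
    have h1 := hG (Pi.single ⟨0, hℓ⟩ 1) (by simp)
    have h2 := wordLabelweight_le L (Matrix.vecMul (Pi.single ⟨0, hℓ⟩ 1) G)
    have h3 : t ≤ d * t := Nat.le_mul_of_pos_left t hd
    rw [Finset.card_univ, Fintype.card_fin]
    omega
  obtain ⟨T₀, -, hT₀⟩ := Finset.exists_subset_card_eq hts
  choose! H hGH hH using fun U : Finset (Fin s) =>
    exists_right_inverse_eq_zero_of_label_mem hG U
  exact ⟨cnfScheme 𝓕 ⟨T₀, hT₀⟩ G L H, isCorrect_cnfScheme h𝓕 hGH hH, isPrivate_cnfScheme,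
    downloadRate_cnfScheme, isReconstructionMatrix_cnfScheme⟩

end LinearHSS

/-! ### Assembling the four claims. -/

theorem theorem3p1 {F : Type*} [Field F] [Finite F] (ℓ t s d m n : ℕ)
    (hd : 0 < d) (hℓ : 0 < ℓ) (hmd : d ≤ m) (hℓn : ℓ ≤ n)
    (𝓕 : Set (Fin ℓ → MvPolynomial (Fin m) F)) (h𝓕 : 𝓕 ⊆ PolyClassPow F d m ℓ)
    (hnt : IsNontrivialClass d 𝓕) :
    -- schemes exist iff codes exist, for arbitrary labelings
    ((∃ π : LinearHSS F s 𝓕, π.IsCorrect ∧ π.IsPrivate t ∧ π.downloadRate = (ℓ : ℝ) / n) ↔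
      ∃ C : Submodule F (Fin n → F), codeRate C = (ℓ : ℝ) / n ∧
        ∃ L : Fin n → Fin s, d * t + 1 ≤ codeLabelweight L C) ∧
    -- the same for surjective labelings, as soon as there are enough coordinates for one
    (s ≤ n →
      ((∃ π : LinearHSS F s 𝓕, π.IsCorrect ∧ π.IsPrivate t ∧ π.downloadRate = (ℓ : ℝ) / n) ↔
        ∃ C : Submodule F (Fin n → F), codeRate C = (ℓ : ℝ) / n ∧
          ∃ L : Fin n → Fin s, Function.Surjective L ∧ d * t + 1 ≤ codeLabelweight L C)) ∧
    -- every scheme has a reconstruction matrix, and each one generates such a code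
    (∀ π : LinearHSS F s 𝓕, π.IsCorrect → π.IsPrivate t → π.downloadRate = (ℓ : ℝ) / n →
      (∃ (G : Matrix (Fin ℓ) (Fin n) F) (L : Fin n → Fin s), π.IsReconstructionMatrix G L) ∧
      ∀ (G : Matrix (Fin ℓ) (Fin n) F) (L : Fin n → Fin s), π.IsReconstructionMatrix G L →
        ∃ C : Submodule F (Fin n → F), IsGeneratorMatrix G C ∧ codeRate C = (ℓ : ℝ) / n ∧
          d * t + 1 ≤ codeLabelweight L C) ∧
    -- every generator matrix of such a code is the reconstruction matrix of a scheme
    (∀ (C : Submodule F (Fin n → F)) (L : Fin n → Fin s), codeRate C = (ℓ : ℝ) / n →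
      d * t + 1 ≤ codeLabelweight L C →
      ∀ G : Matrix (Fin ℓ) (Fin n) F, IsGeneratorMatrix G C →
        ∃ π : LinearHSS F s 𝓕, π.IsCorrect ∧ π.IsPrivate t ∧
          π.downloadRate = (ℓ : ℝ) / n ∧ π.IsReconstructionMatrix G L) := by
  have hn : 0 < n := hℓ.trans_le hℓn
  have key : ∀ π : LinearHSS F s 𝓕, π.IsCorrect → π.IsPrivate t → π.downloadRate = (ℓ : ℝ) / n →
      (∃ (G : Matrix (Fin ℓ) (Fin n) F) (L : Fin n → Fin s), π.IsReconstructionMatrix G L) ∧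
      ∀ (G : Matrix (Fin ℓ) (Fin n) F) (L : Fin n → Fin s), π.IsReconstructionMatrix G L →
        ∃ C : Submodule F (Fin n → F), IsGeneratorMatrix G C ∧ codeRate C = (ℓ : ℝ) / n ∧
          d * t + 1 ≤ codeLabelweight L C := by
    intro π hc hp hr
    refine ⟨π.exists_isReconstructionMatrix (LinearHSS.sum_outLen_eq hℓ hr), fun G L hGL => ?_⟩
    have hlt := fun u (hu : u ≠ 0) => LinearHSS.lt_wordLabelweight_vecMul hd h𝓕 hnt hc hp hGL hu
    have hgen := IsGeneratorMatrix.of_vecMul_ne_zero (G := G) fun u hu h0 => by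
      have := hlt u hu
      rw [h0, wordLabelweight_zero] at this
      exact Nat.not_lt_zero _ this
    exact ⟨_, hgen, (codeRate_eq_div_iff hn).2 hgen.1, (hgen.lt_codeLabelweight_iff hℓ).2 hlt⟩
  have conv : ∀ (C : Submodule F (Fin n → F)) (L : Fin n → Fin s), codeRate C = (ℓ : ℝ) / n →
      d * t + 1 ≤ codeLabelweight L C →
      ∀ G : Matrix (Fin ℓ) (Fin n) F, IsGeneratorMatrix G C →
        ∃ π : LinearHSS F s 𝓕, π.IsCorrect ∧ π.IsPrivate t ∧
          π.downloadRate = (ℓ : ℝ) / n ∧ π.IsReconstructionMatrix G L := fun C L _ hL G hG =>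
    LinearHSS.exists_isReconstructionMatrix_of_lt_wordLabelweight hd hℓ h𝓕
      ((hG.lt_codeLabelweight_iff hℓ).1 hL)
  have fwd : (∃ π : LinearHSS F s 𝓕, π.IsCorrect ∧ π.IsPrivate t ∧
      π.downloadRate = (ℓ : ℝ) / n) → ∃ C : Submodule F (Fin n → F), codeRate C = (ℓ : ℝ) / n ∧
        ∃ L : Fin n → Fin s, d * t + 1 ≤ codeLabelweight L C := by
    rintro ⟨π, hc, hp, hr⟩
    obtain ⟨⟨G, L, hGL⟩, h⟩ := key π hc hp hr
    obtain ⟨C, -, hC, hL⟩ := h G L hGL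
    exact ⟨C, hC, L, hL⟩
  have bwd : ∀ (C : Submodule F (Fin n → F)) (L : Fin n → Fin s), codeRate C = (ℓ : ℝ) / n →
      d * t + 1 ≤ codeLabelweight L C → ∃ π : LinearHSS F s 𝓕, π.IsCorrect ∧ π.IsPrivate t ∧
        π.downloadRate = (ℓ : ℝ) / n := by
    intro C L hC hL
    obtain ⟨G, hG⟩ := exists_isGeneratorMatrix ((codeRate_eq_div_iff hn).1 hC)
    obtain ⟨π, hc, hp, hr, -⟩ := conv C L hC hL G hG
    exact ⟨π, hc, hp, hr⟩
  refine ⟨⟨fwd, fun ⟨C, hC, L, hL⟩ => bwd C L hC hL⟩, fun hsn => ⟨fun h => ?_,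
    fun ⟨C, hC, L, _, hL⟩ => bwd C L hC hL⟩, key, conv⟩
  obtain ⟨C, hC, L, hL⟩ := fwd h
  -- Merging labels can only lower labelweights, so the finer surjective labeling inherits the
  -- bound.
  obtain ⟨L', g, hL', rfl⟩ := exists_surjective_labeling_comp hsn L
  exact ⟨C, hC, L', hL', hL.trans (codeLabelweight_comp_le g L' C)⟩
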